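/- Write $\mathbb{N}=\{1,2,3,\dots\}$. A Følner sequence in $\mathbb{N}$ is a sequence $\Phi=(\Phi_N)$ of nonempty finite subsets of $\mathbb{N}$ with $|\Phi_N\triangle(\Phi_N+m)|/|\Phi_N|\to 0$ for every $m\in\mathbb{N}$. A set $A\subseteq\mathbb{N}$ has positive upper Banach density if $\lim_{N\to\infty}|A\cap\Phi_N|/|\Phi_N|$ exists and is positive for some Følner sequence $\Phi$. An ergodic system $(X,\mu,T)$ is a compact metric space $X$ with a homeomorphism $T:X\to X$ and a $T$-invariant Borel probability measure $\mu$ such that every $T$-invariant Borel set has measure $0$ or $1$. Let $k\in\mathbb{N}$ and let $A\subseteq\mathbb{N}$ have positive upper Banach density. Then there exist an ergodic system $(X,\mu,T)$, a $T^k$-invariant and $T^k$-ergodic Borel probability measure $\mu_k$ on $X$ which gives the ergodic decomposition $$\mu=\frac1k\sum_{j=0}^{k-1}T^j\mu_k$$ of $\mu$ with respect to $T^k$ (where $T^j\mu_k$ is the push-forward of $\mu_k$ under $T^j$), a Følner sequence $\Phi$ in $\mathbb{N}$, a point $a\in X$, and a clopen set $E\subseteq X$ such that 1. $a$ is generic for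 $\mu_k$ along $\Phi$ under $T^k$, i.e. $\displaystyle\lim_{N\to\infty}\frac1{|\Phi_N|}\sum_{n\in\Phi_N}f(T^{kn}a)=\int_X f\,d\mu_k$ for every continuous $f:X\to\mathbb{C}$; 2. $\mu\big(\overline{\{T^na:n\in\mathbb{N}\}}\big)=1$; 3. $\mu(E)>0$ and $A=\{n\in\mathbb{N}: T^na\in E\}$. -/

import Mathlib

open Filter Topology MeasureTheory
open scoped ENNReal

/-- A Følner sequence in `ℕ = {1, 2, 3, …}`: a sequence of nonempty finite sets `Φ N` of positive
integers with `|Φ N ∆ (Φ N + k)| / |Φ N| → 0` for every positive integer `k`. -/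
structure IsFolner (Φ : ℕ → Finset ℕ+) : Prop where
  nonempty : ∀ N, (Φ N).Nonempty
  tendsto : ∀ k : ℕ+, Tendsto
    (fun N => ((symmDiff (Φ N) ((Φ N).image (fun n => n + k))).card : ℝ) / ((Φ N).card : ℝ))
    atTop (𝓝 0)

/-- `A` has positive upper Banach density: along some Følner sequence the relative density of `A`
converges to a positive limit. -/
def HasPosUpperBanachDensity (A : Set ℕ+) : Prop :=
  ∃ Φ : ℕ → Finset ℕ+, IsFolner Φ ∧ ∃ δ : ℝ, 0 < δ ∧
    Tendsto (fun N => ((A ∩ (Φ N : Set ℕ+)).ncard : ℝ) / ((Φ N).card : ℝ)) atTop (𝓝 δ)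

/-- `y ∈ gen_S(ν, Φ)`: the point `y` is generic for `ν` along `Φ` under the map `S`. -/
def IsGeneric {X : Type*} [TopologicalSpace X] [MeasurableSpace X]
    (S : X → X) (ν : Measure X) (Φ : ℕ → Finset ℕ+) (y : X) : Prop :=
  ∀ f : C(X, ℂ), Tendsto
    (fun N => (((Φ N).card : ℂ))⁻¹ * ∑ n ∈ Φ N, f (S^[(n : ℕ)] y)) atTop (𝓝 (∫ x, f x ∂ν))

/-- `(X, μ, T)` is an ergodic system: `μ` is a `T`-invariant probability measure for which every
measurable `T`-invariant set is null or co-null. (`X` is a compact metric space with its Borel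
σ-algebra and `T` a homeomorphism.) -/
structure IsErgodicSystem {X : Type*} [MetricSpace X] [CompactSpace X] [MeasurableSpace X]
    [BorelSpace X] (T : X ≃ₜ X) (μ : Measure X) : Prop where
  prob : IsProbabilityMeasure μ
  ergodic : Ergodic T μ

/-- `ν` is a measure `μ_k` for `(X, μ, T)`: a `T ^ k`-invariant and `T ^ k`-ergodic probability
measure such that `μ = (1 / k) ∑_{j < k} T ^ j ν` is the ergodic decomposition of `μ` with respect
to `T ^ k`. -/
structure IsPowErgodicComponent {X : Type*} [MeasurableSpace X]
    (T : X → X) (k : ℕ+) (μ ν : Measure X) : Prop where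
  prob : IsProbabilityMeasure ν
  ergodic : Ergodic (T^[(k : ℕ)]) ν
  decomp : μ = ((k : ℕ) : ℝ≥0∞)⁻¹ • ∑ j ∈ Finset.range (k : ℕ), ν.map (T^[j])

/-! Encode `A` as a 0-1 sequence `a` in the two-sided shift `T`, with `E` the cylinder reading
coordinate `0`, so that `A` is the set of return times of `a` to `E`. Put `S = T^k`. Since `n = k *
(n / k) + n % k`, each `n ∈ A` is a visit to `E` among the first `k` points of the `T`-orbit of
`S^[n / k] a`. Averaging over `S^[n / k] a` along the given Følner sequence thus yields an
`S`-invariant state, carried by the `S`-orbit closure of `a`, under which the visit count is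
positive (`exists_visitCount_pos_state`). The states maximising the visit count form a compact
exposed face, and an extreme point of it is an ergodic measure `ν` (`exists_ergodic_le_integral`);
this is `μ_k`. By the mean ergodic theorem, long Birkhoff averages are near their integrals except
on a set of small `ν`-measure. As `ν` lives on the orbit closure, some orbit point is good, and
windows starting there form the new Følner sequence (`exists_isFolner_isGeneric`). Averaging the
push-forwards of `ν` under `T^j`, `j < k`, gives `μ`. -/

section

/-! ### Invariant states on an orbit closure and their ergodic extreme points -/

open scoped CompactlySupported

variable {X : Type*} [MetricSpace X]

/-- The `S`-invariant normalised linear functionals on `C(X, ℝ)` that are nonnegative on functions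
which are nonnegative along the forward orbit of `a`. -/
def orbitStates (S : C(X, X)) (a : X) : Set (WeakDual ℝ C(X, ℝ)) :=
  {Λ | (∀ f : C(X, ℝ), (∀ n : ℕ, 0 ≤ f (S^[n] a)) → 0 ≤ Λ f) ∧ Λ 1 = 1 ∧
    ∀ f : C(X, ℝ), Λ (f.comp S) = Λ f}

theorem isClosed_orbitStates (S : C(X, X)) (a : X) : IsClosed (orbitStates S a) := by
  simp only [orbitStates, Set.ofPred_and, Set.ofPred_forall]
  refine (isClosed_iInter fun f => isClosed_iInter fun _ => ?_).inter
    (IsClosed.inter ?_ (isClosed_iInter fun f => ?_))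
  · exact isClosed_le continuous_const (WeakDual.eval_continuous f)
  · exact isClosed_eq (WeakDual.eval_continuous _) continuous_const
  · exact isClosed_eq (WeakDual.eval_continuous _) (WeakDual.eval_continuous f)

variable [CompactSpace X]

theorem abs_apply_le_of_mem_orbitStates {S : C(X, X)} {a : X} {Λ : WeakDual ℝ C(X, ℝ)}
    (h : Λ ∈ orbitStates S a) (f : C(X, ℝ)) : |Λ f| ≤ ‖f‖ := by
  have h1 : Λ (ContinuousMap.const X ‖f‖) = ‖f‖ := by
    have : ContinuousMap.const X ‖f‖ = ‖f‖ • (1 : C(X, ℝ)) := by ext; simp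
    rw [this, map_smul, h.2.1, smul_eq_mul, mul_one]
  have hf (x : X) := abs_le.1 (f.norm_coe_le_norm x)
  rw [abs_le]
  constructor
  · have := h.1 (f + ContinuousMap.const X ‖f‖) fun n => by
      have := (hf (S^[n] a)).1
      simp only [ContinuousMap.add_apply, ContinuousMap.const_apply]
      linarith
    rw [map_add, h1] at this
    linarith
  · have := h.1 (ContinuousMap.const X ‖f‖ - f) fun n => by
      have := (hf (S^[n] a)).2
      simp only [ContinuousMap.sub_apply, ContinuousMap.const_apply]
      linarith
    rw [map_sub, h1] at this
    linarith

theorem isCompact_orbitStates (S : C(X, X)) (a : X) : IsCompact (orbitStates S a) := by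
  refine (WeakDual.isCompact_closedBall (0 : StrongDual ℝ C(X, ℝ)) 1).of_isClosed_subset
    (isClosed_orbitStates S a) fun Λ h => ?_
  rw [Set.mem_preimage, mem_closedBall_zero_iff]
  refine ContinuousLinearMap.opNorm_le_bound _ zero_le_one fun f => ?_
  rw [one_mul]
  exact abs_apply_le_of_mem_orbitStates h f

variable [MeasurableSpace X] [BorelSpace X]

theorem integrable_continuousMap {F : Type*} [NormedAddCommGroup F] [SecondCountableTopology F]
    (ν : Measure X) [IsFiniteMeasure ν] (f : C(X, F)) : Integrable f ν :=
  f.continuous.integrable_of_hasCompactSupport (HasCompactSupport.of_compactSpace f)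

/-- Integration against a finite measure, as an element of the weak dual of `C(X, ℝ)`. -/
noncomputable def integralFunctional (ν : Measure X) [IsFiniteMeasure ν] :
    WeakDual ℝ C(X, ℝ) :=
  StrongDual.toWeakDual <| LinearMap.mkContinuous
    { toFun := fun f => ∫ x, f x ∂ν
      map_add' := fun f g => integral_add (integrable_continuousMap ν f)
        (integrable_continuousMap ν g)
      map_smul' := fun c f => integral_smul c f } (ν.real Set.univ) fun f => by
    rw [mul_comm]
    exact norm_integral_le_of_norm_le_const (.of_forall f.norm_coe_le_norm)

@[simp] theorem integralFunctional_apply (ν : Measure X) [IsFiniteMeasure ν] (f : C(X, ℝ)) :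
    integralFunctional ν f = ∫ x, f x ∂ν := rfl

theorem exists_isProbabilityMeasure_integral_eq {Λ : WeakDual ℝ C(X, ℝ)}
    (hpos : ∀ f : C(X, ℝ), 0 ≤ f → 0 ≤ Λ f) (hone : Λ 1 = 1) :
    ∃ (ν : Measure X) (_ : IsProbabilityMeasure ν), Λ = integralFunctional ν := by
  let L : C_c(X, ℝ) →ₗ[ℝ] ℝ :=
    { toFun := fun f => Λ f.toContinuousMap
      map_add' := fun f g => map_add Λ f.toContinuousMap g.toContinuousMap
      map_smul' := fun c f => map_smul Λ c f.toContinuousMap }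
  let P : C_c(X, ℝ) →ₚ[ℝ] ℝ := PositiveLinearMap.mk₀ L fun f hf => hpos f.toContinuousMap hf
  have hP (f : C(X, ℝ)) : ∫ x, f x ∂(RealRMK.rieszMeasure P) = Λ f :=
    RealRMK.integral_rieszMeasure P (CompactlySupportedContinuousMap.continuousMapEquiv f)
  have hprob : IsProbabilityMeasure (RealRMK.rieszMeasure P) := by
    have h1 := hP 1
    simp only [ContinuousMap.one_apply, integral_const, smul_eq_mul, mul_one, hone] at h1
    constructor
    rw [measureReal_def] at h1
    rwa [ENNReal.toReal_eq_one_iff] at h1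
  exact ⟨_, hprob, DFunLike.ext _ _ fun f => (hP f).symm⟩

theorem measurePreserving_of_integralFunctional_comp {S : C(X, X)} {ν : Measure X}
    [IsFiniteMeasure ν]
    (h : ∀ f : C(X, ℝ), integralFunctional ν (f.comp S) = integralFunctional ν f) :
    MeasurePreserving S ν ν := by
  refine ⟨S.continuous.measurable, ?_⟩
  refine ext_of_forall_integral_eq_of_IsFiniteMeasure fun f => ?_
  rw [integral_map S.continuous.aemeasurable f.continuous.aestronglyMeasurable]
  exact h f.toContinuousMap

/-- Positivity on the orbit amounts to `ν` being carried by the orbit closure, a property inherited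
by absolutely continuous measures. -/
theorem integralFunctional_mem_orbitStates {S : C(X, X)} {a : X} {ν ν' : Measure X}
    [IsFiniteMeasure ν] [IsProbabilityMeasure ν']
    (h : integralFunctional ν ∈ orbitStates S a) (hac : ν' ≪ ν) (hS : MeasurePreserving S ν' ν') :
    integralFunctional ν' ∈ orbitStates S a := by
  refine ⟨fun f hf => ?_, by simp, fun f => ?_⟩
  · refine integral_nonneg_of_ae (hac.ae_le ?_)
    -- The negative part of `f` vanishes on the orbit, so positivity applied to `-g` forces its
    -- integral to be zero.
    let g : C(X, ℝ) := (-f) ⊔ 0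
    have hg0 : 0 ≤ g := le_sup_right
    have hg : ∫ x, g x ∂ν = 0 := by
      refine le_antisymm ?_ (integral_nonneg hg0)
      have := h.1 (-g) fun n => by simp [g, hf n]
      rw [map_neg] at this
      simpa using this
    rw [integral_eq_zero_iff_of_nonneg (f := g) hg0 (integrable_continuousMap ν g)] at hg
    filter_upwards [hg] with x hx
    simpa [g] using hx
  · rw [integralFunctional_apply, integralFunctional_apply]
    conv_rhs => rw [← hS.map_eq]
    rw [integral_map S.continuous.aemeasurable f.continuous.aestronglyMeasurable]
    rfl

theorem integralFunctional_injective {ν ν' : Measure X} [IsFiniteMeasure ν] [IsFiniteMeasure ν']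
    (h : integralFunctional ν = integralFunctional ν') : ν = ν' :=
  ext_of_forall_integral_eq_of_IsFiniteMeasure fun f => DFunLike.congr_fun h f.toContinuousMap

/-- Both parts of a convex decomposition of `ν` into invariant measures are absolutely continuous
with respect to `ν`, hence again states of the orbit. Extremality here therefore gives extremality
among all invariant probability measures. -/
theorem ergodic_of_integralFunctional_mem_extremePoints {S : C(X, X)} {a : X} {ν : Measure X}
    [IsProbabilityMeasure ν]
    (h : integralFunctional ν ∈ (orbitStates S a).extremePoints ℝ) : Ergodic S ν := by
  refine Ergodic.of_mem_extremePoints ?_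
  rw [mem_extremePoints_iff_left]
  refine ⟨⟨measurePreserving_of_integralFunctional_comp h.1.2.2, inferInstance⟩, ?_⟩
  rintro ν₁ ⟨hS₁, hp₁⟩ ν₂ ⟨hS₂, hp₂⟩ ⟨s, t, hs, ht, hst, rfl⟩
  have hs' : s ≠ ∞ := fun h => by simp [h] at hst
  have ht' : t ≠ ∞ := fun h => by simp [h] at hst
  have hac₁ : ν₁ ≪ s • ν₁ + t • ν₂ :=
    (Measure.absolutelyContinuous_smul hs.ne').trans (.add_right .rfl _)
  have hac₂ : ν₂ ≪ s • ν₁ + t • ν₂ :=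
    (Measure.absolutelyContinuous_smul ht.ne').trans (by rw [add_comm]; exact .add_right .rfl _)
  refine integralFunctional_injective (h.2 (integralFunctional_mem_orbitStates h.1 hac₁ hS₁)
    (integralFunctional_mem_orbitStates h.1 hac₂ hS₂)
    ⟨s.toReal, t.toReal, ENNReal.toReal_pos hs.ne' hs', ENNReal.toReal_pos ht.ne' ht', ?_, ?_⟩)
  · rw [← ENNReal.toReal_add hs' ht', hst, ENNReal.toReal_one]
  · refine DFunLike.ext _ _ fun f => ?_
    have := integral_add_measure ((integrable_continuousMap ν₁ f).smul_measure hs')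
      ((integrable_continuousMap ν₂ f).smul_measure ht')
    rw [integral_smul_measure, integral_smul_measure] at this
    exact this.symm

instance : LocallyConvexSpace ℝ (WeakDual ℝ C(X, ℝ)) :=
  WeakBilin.locallyConvexSpace

/-- The maximisers of `Λ ↦ Λ φ` form a nonempty compact exposed face; it has an extreme point, which
is extreme in the whole set of states. -/
theorem exists_ergodic_le_integral {S : C(X, X)} {a : X} {Λ : WeakDual ℝ C(X, ℝ)}
    (hΛ : Λ ∈ orbitStates S a) (φ : C(X, ℝ)) :
    ∃ (ν : Measure X) (_ : IsProbabilityMeasure ν), Ergodic S ν ∧ Λ φ ≤ ∫ x, φ x ∂ν ∧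
      ∀ f : C(X, ℝ), (∀ n : ℕ, 0 ≤ f (S^[n] a)) → 0 ≤ ∫ x, f x ∂ν := by
  let l : StrongDual ℝ (WeakDual ℝ C(X, ℝ)) :=
    { toFun := fun Λ => Λ φ
      map_add' := fun _ _ => rfl
      map_smul' := fun _ _ => rfl
      cont := WeakDual.eval_continuous φ }
  have hexp := ContinuousLinearMap.toExposed.isExposed (l := l) (A := orbitStates S a)
  have hK := isCompact_orbitStates S a
  obtain ⟨M, hM, hmax⟩ := hK.exists_isMaxOn ⟨Λ, hΛ⟩ l.continuous.continuousOn
  obtain ⟨Ψ, hΨ⟩ := (hexp.isCompact hK).extremePoints_nonempty ⟨M, hM, fun y hy => hmax hy⟩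
  have hΨ' := hexp.isExtreme.extremePoints_subset_extremePoints hΨ
  obtain ⟨ν, hν, rfl⟩ := exists_isProbabilityMeasure_integral_eq
    (fun f hf => hΨ'.1.1 f fun n => hf _) hΨ'.1.2.1
  exact ⟨ν, hν, ergodic_of_integralFunctional_mem_extremePoints hΨ', hΨ.1.2 Λ hΛ, hΨ'.1.1⟩

end

/-! ### Limits of Følner averages -/

section

variable {X : Type*} [MetricSpace X]

theorem abs_sum_add_sub_sum_le (s : Finset ℕ+) (k : ℕ+) {g : ℕ+ → ℝ} {C : ℝ}
    (hg : ∀ n, |g n| ≤ C) :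
    |∑ n ∈ s, g (n + k) - ∑ n ∈ s, g n| ≤
      C * (symmDiff s (s.image fun n => n + k)).card := by
  have h1 : ∑ n ∈ s, g (n + k) = ∑ n ∈ s.image fun n => n + k, g n :=
    (Finset.sum_image (by intro x _ y _ h; simpa using h)).symm
  set t := s.image fun n => n + k
  rw [h1, ← Finset.sum_sdiff_sub_sum_sdiff, symmDiff_def, Finset.sup_eq_union,
    Finset.card_union_of_disjoint disjoint_sdiff_sdiff, Nat.cast_add, mul_add, add_comm (C * _)]
  have hb (u : Finset ℕ+) : |∑ n ∈ u, g n| ≤ C * u.card := by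
    refine (Finset.abs_sum_le_sum_abs _ _).trans ((Finset.sum_le_card_nsmul _ _ C
      fun n _ => hg n).trans ?_)
    rw [nsmul_eq_mul, mul_comm]
  exact (abs_sub _ _).trans (add_le_add (hb _) (hb _))

/-- The average of `f` over the points `p n` with `n ∈ s`, as a functional of `f`. -/
noncomputable def averageFunctional (p : ℕ+ → X) (s : Finset ℕ+) : WeakDual ℝ C(X, ℝ) :=
  StrongDual.toWeakDual ((s.card : ℝ)⁻¹ • ∑ n ∈ s, ContinuousMap.evalCLM ℝ (p n))

theorem averageFunctional_apply (p : ℕ+ → X) (s : Finset ℕ+) (f : C(X, ℝ)) :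
    averageFunctional p s f = (s.card : ℝ)⁻¹ * ∑ n ∈ s, f (p n) := by
  change ((s.card : ℝ)⁻¹ • ∑ n ∈ s, ContinuousMap.evalCLM ℝ (p n)) f = _
  simp

variable [CompactSpace X]

theorem averageFunctional_mem_closedBall (p : ℕ+ → X) (s : Finset ℕ+) :
    averageFunctional p s ∈
      WeakDual.toStrongDual ⁻¹' Metric.closedBall (0 : StrongDual ℝ C(X, ℝ)) 1 := by
  refine (mem_closedBall_zero_iff (E := StrongDual ℝ C(X, ℝ))).2 ?_
  refine ContinuousLinearMap.opNorm_le_bound _ zero_le_one fun f => ?_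
  change ‖averageFunctional p s f‖ ≤ _
  rw [averageFunctional_apply, norm_mul, norm_inv, RCLike.norm_natCast, one_mul]
  have h : ‖∑ n ∈ s, f (p n)‖ ≤ s.card * ‖f‖ := by
    refine (norm_sum_le _ _).trans ((Finset.sum_le_card_nsmul _ _ ‖f‖
      fun n _ => f.norm_coe_le_norm _).trans ?_)
    rw [nsmul_eq_mul]
  rcases s.eq_empty_or_nonempty with rfl | hs
  · simp
  · rwa [inv_mul_le_iff₀ (by exact_mod_cast hs.card_pos)]

/-- Averages of `f (S^[n / k] a)` along a Følner sequence accumulate at an invariant state. -/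
theorem exists_mem_orbitStates_of_isFolner (S : C(X, X)) (a : X) (k : ℕ+)
    {Φ : ℕ → Finset ℕ+} (hΦ : IsFolner Φ) {φ : C(X, ℝ)} {u : ℕ → ℝ} {δ : ℝ}
    (hu : Tendsto u atTop (𝓝 δ))
    (hφ : ∀ N, u N ≤ ((Φ N).card : ℝ)⁻¹ * ∑ n ∈ Φ N, φ (S^[(n : ℕ) / k] a)) :
    ∃ Λ ∈ orbitStates S a, δ ≤ Λ φ := by
  let p : ℕ+ → X := fun n => S^[(n : ℕ) / k] a
  let L : ℕ → WeakDual ℝ C(X, ℝ) := fun N => averageFunctional p (Φ N)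
  let U : Ultrafilter ℕ := Ultrafilter.of atTop
  have hU : (U : Filter ℕ) ≤ atTop := Ultrafilter.of_le atTop
  have hcard (N : ℕ) : (0 : ℝ) < (Φ N).card := by exact_mod_cast (hΦ.nonempty N).card_pos
  obtain ⟨Λ, -, hΛ⟩ := (WeakDual.isCompact_closedBall (0 : StrongDual ℝ C(X, ℝ)) 1)
    |>.ultrafilter_le_nhds (U.map L) (le_principal_iff.2 <| Ultrafilter.mem_map.2 <|
      Filter.univ_mem' fun N => averageFunctional_mem_closedBall p (Φ N))
  have hlim (f : C(X, ℝ)) : Tendsto (fun N => L N f) U (𝓝 (Λ f)) :=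
    ((WeakDual.eval_continuous f).tendsto Λ).comp (show Tendsto L U (𝓝 Λ) from hΛ)
  have hL (N : ℕ) (f : C(X, ℝ)) : L N f = ((Φ N).card : ℝ)⁻¹ * ∑ n ∈ Φ N, f (p n) :=
    averageFunctional_apply p (Φ N) f
  refine ⟨Λ, ⟨fun f hf => ?_, ?_, fun f => ?_⟩, ?_⟩
  · refine ge_of_tendsto' (hlim f) fun N => ?_
    rw [hL]
    exact mul_nonneg (inv_nonneg.2 (hcard N).le) (Finset.sum_nonneg fun n _ => hf _)
  · refine tendsto_nhds_unique (hlim 1) (tendsto_const_nhds.congr fun N => ?_)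
    rw [hL]
    simp [(hcard N).ne']
  · have hdiff : Tendsto (fun N => L N (f.comp S) - L N f) U (𝓝 0) := by
      refine squeeze_zero_norm (fun N => ?_) (by
        simpa using ((hΦ.tendsto k).const_mul ‖f‖).mono_left hU)
      -- Translating `n` by `k` raises `n / k` by one, so the Følner property for the shift `k`
      -- yields `S`-invariance.
      have hp (n : ℕ+) : f.comp S (p n) = f (p (n + k)) := by
        have : ((n + k : ℕ+) : ℕ) / k = (n : ℕ) / k + 1 := by
          rw [PNat.add_coe, Nat.add_div_right _ k.pos]
        simp only [p, this, Function.iterate_succ_apply', ContinuousMap.comp_apply]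
      rw [hL, hL, ← mul_sub, norm_mul, norm_inv, RCLike.norm_natCast,
        inv_mul_le_iff₀ (hcard N), mul_left_comm, mul_div_cancel₀ _ (hcard N).ne']
      simp only [hp]
      exact abs_sum_add_sub_sum_le (Φ N) k fun n => f.norm_coe_le_norm (p n)
    exact sub_eq_zero.1 (tendsto_nhds_unique ((hlim (f.comp S)).sub (hlim f)) hdiff)
  · exact le_of_tendsto_of_tendsto' (hu.mono_left hU) (hlim φ) fun N => by
      rw [hL]; exact hφ N

end

/-! ### The mean ergodic theorem and generic points -/

section

variable {X : Type*} [MetricSpace X]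

/-- The Birkhoff averages of a continuous function, as continuous functions. -/
noncomputable def birkhoffMap (S : C(X, X)) (N : ℕ) (f : C(X, ℂ)) : C(X, ℂ) :=
  birkhoffAverage ℂ (fun g : C(X, ℂ) => g.comp S) id N f

theorem iterate_comp_apply (S : C(X, X)) (f : C(X, ℂ)) (n : ℕ) (x : X) :
    ((fun g : C(X, ℂ) => g.comp S)^[n] f) x = f (S^[n] x) := by
  induction n generalizing x with
  | zero => rfl
  | succ n ih =>
    rw [Function.iterate_succ_apply', ContinuousMap.comp_apply, ih, Function.iterate_succ_apply]

theorem birkhoffMap_apply (S : C(X, X)) (N : ℕ) (f : C(X, ℂ)) (x : X) :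
    birkhoffMap S N f x = (N : ℂ)⁻¹ * ∑ n ∈ Finset.range N, f (S^[n] x) := by
  simp [birkhoffMap, birkhoffAverage, birkhoffSum, iterate_comp_apply]

theorem birkhoffMap_sub_const (S : C(X, X)) {N : ℕ} (hN : N ≠ 0) (f : C(X, ℂ)) (c : ℂ) (x : X) :
    birkhoffMap S N (f - ContinuousMap.const X c) x = birkhoffMap S N f x - c := by
  have : (N : ℂ) ≠ 0 := Nat.cast_ne_zero.2 hN
  simp only [birkhoffMap_apply, ContinuousMap.sub_apply, ContinuousMap.const_apply,
    Finset.sum_sub_distrib, Finset.sum_const, Finset.card_range, nsmul_eq_mul]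
  field_simp

variable [CompactSpace X] [MeasurableSpace X] [BorelSpace X]

theorem toLp_birkhoffMap {S : C(X, X)} {ν : Measure X} [IsFiniteMeasure ν]
    (hS : MeasurePreserving S ν ν) (N : ℕ) (f : C(X, ℂ)) :
    ContinuousMap.toLp 2 ν ℂ (birkhoffMap S N f) =
      birkhoffAverage ℂ (Lp.compMeasurePreservingₗᵢ ℂ S hS) id N
        (ContinuousMap.toLp 2 ν ℂ f) := by
  have hsemi : Function.Semiconj (ContinuousMap.toLp 2 ν ℂ) (fun g : C(X, ℂ) => g.comp S)
      (Lp.compMeasurePreservingₗᵢ (E := ℂ) (p := 2) ℂ S hS) := fun g => rfl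
  simp only [birkhoffMap, birkhoffAverage, birkhoffSum, id, map_smul, map_sum,
    (hsemi.iterate_right _).eq]

/-- The mean ergodic theorem for a mean zero continuous function. -/
theorem tendsto_toLp_birkhoffMap {S : C(X, X)} {ν : Measure X} [IsProbabilityMeasure ν]
    (hS : Ergodic S ν) {f : C(X, ℂ)} (hf : ∫ x, f x ∂ν = 0) :
    Tendsto (fun N => ContinuousMap.toLp 2 ν ℂ (birkhoffMap S N f)) atTop (𝓝 0) := by
  let U := (Lp.compMeasurePreservingₗᵢ (E := ℂ) (p := 2) ℂ S
    hS.toMeasurePreserving).toContinuousLinearMap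
  have h := U.tendsto_birkhoffAverage_orthogonalProjection
    (LinearIsometry.norm_toContinuousLinearMap_le _) (ContinuousMap.toLp 2 ν ℂ f)
  -- Ergodicity makes the fixed vectors constant, and a mean zero function is orthogonal to
  -- constants.
  have hproj : ContinuousMap.toLp 2 ν ℂ f ∈ (U.eqLocus (1 : Lp ℂ 2 ν →L[ℂ] Lp ℂ 2 ν))ᗮ := by
    rw [Submodule.mem_orthogonal]
    intro g hg
    have hg' : U g = g := hg
    have hcomp : g ∘ S =ᵐ[ν] g := by
      refine (Lp.coeFn_compMeasurePreserving g hS.toMeasurePreserving).symm.trans ?_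
      exact Filter.EventuallyEq.of_eq (congrArg (fun h : Lp ℂ 2 ν => (h : X → ℂ)) hg')
    obtain ⟨c, hc⟩ := hS.ae_eq_const_of_ae_eq_comp_ae (Lp.aestronglyMeasurable g) hcomp
    rw [L2.inner_def]
    calc ∫ x, inner ℂ (g x) (ContinuousMap.toLp 2 ν ℂ f x) ∂ν
        = ∫ x, f x * (starRingEnd ℂ) c ∂ν := by
          refine integral_congr_ae ?_
          filter_upwards [hc, ContinuousMap.coeFn_toLp (p := 2) (𝕜 := ℂ) ν f] with x h1 h2
          rw [h1, h2]
          rfl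
      _ = 0 := by rw [integral_mul_const, hf, zero_mul]
  rw [(Submodule.orthogonalProjectionOnto_eq_zero_iff).2 hproj] at h
  simp only [toLp_birkhoffMap hS.toMeasurePreserving]
  exact h

theorem norm_sq_toLp {ν : Measure X} [IsFiniteMeasure ν] (g : C(X, ℂ)) :
    ‖ContinuousMap.toLp 2 ν ℂ g‖ ^ 2 = ∫ x, ‖g x‖ ^ 2 ∂ν := by
  have h := congrArg RCLike.re (L2.inner_def (𝕜 := ℂ) (ContinuousMap.toLp 2 ν ℂ g)
    (ContinuousMap.toLp 2 ν ℂ g))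
  rw [← @norm_sq_eq_re_inner ℂ] at h
  rw [h, ← integral_re (L2.integrable_inner _ _)]
  refine integral_congr_ae ?_
  filter_upwards [ContinuousMap.coeFn_toLp (p := 2) (𝕜 := ℂ) ν g] with x hx
  rw [hx, ← @norm_sq_eq_re_inner ℂ]

/-- If `ν` charges only the orbit closure of `a`, then long Birkhoff averages of finitely many
continuous functions are simultaneously close to their integrals at some point of the orbit. -/
theorem eventually_exists_birkhoffMap_close {S : C(X, X)} {a : X} {ν : Measure X}
    [IsProbabilityMeasure ν] (hS : Ergodic S ν)
    (hν : ∀ f : C(X, ℝ), (∀ n : ℕ, 0 ≤ f (S^[n] a)) → 0 ≤ ∫ x, f x ∂ν)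
    (s : Finset C(X, ℂ)) {ε : ℝ} (hε : 0 < ε) :
    ∀ᶠ N in atTop, ∃ m : ℕ, ∀ f ∈ s, ‖birkhoffMap S N f (S^[m] a) - ∫ x, f x ∂ν‖ < ε := by
  let f₀ : C(X, ℂ) → C(X, ℂ) := fun f => f - ContinuousMap.const X (∫ x, f x ∂ν)
  have hf₀ (f : C(X, ℂ)) : ∫ x, f₀ f x ∂ν = 0 := by
    simp only [f₀, ContinuousMap.sub_apply, ContinuousMap.const_apply]
    rw [integral_sub (integrable_continuousMap ν f) (integrable_const _)]
    simp
  let G : ℕ → C(X, ℂ) → C(X, ℝ) := fun N f => ⟨fun x => ‖birkhoffMap S N (f₀ f) x‖ ^ 2, by fun_prop⟩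
  have hG : Tendsto (fun N => ∑ f ∈ s, ∫ x, G N f x ∂ν) atTop (𝓝 0) := by
    rw [← Finset.sum_const_zero (s := s)]
    refine tendsto_finsetSum _ fun f _ => ?_
    have := ((tendsto_toLp_birkhoffMap hS (hf₀ f)).norm).pow 2
    simp only [norm_sq_toLp] at this
    simpa [G] using this
  filter_upwards [hG.eventually_lt_const (pow_pos hε 2), eventually_ne_atTop 0] with N hN hN0
  by_contra! hcon
  -- If every orbit point failed for some `f ∈ s`, then `∑ G N f - ε ^ 2` would be nonnegative on
  -- the orbit, so its integral would be too.
  have hpos := hν (∑ f ∈ s, G N f - ContinuousMap.const X (ε ^ 2)) fun n => by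
    obtain ⟨f, hf, hle⟩ := hcon n
    rw [← birkhoffMap_sub_const S hN0] at hle
    have h1 : ε ^ 2 ≤ G N f (S^[n] a) := pow_le_pow_left₀ hε.le hle 2
    have h2 : G N f (S^[n] a) ≤ ∑ f ∈ s, G N f (S^[n] a) :=
      Finset.single_le_sum (f := fun f => G N f (S^[n] a)) (fun f _ => sq_nonneg _) hf
    simpa [ContinuousMap.sum_apply] using h1.trans h2
  simp only [ContinuousMap.sub_apply, ContinuousMap.const_apply, ContinuousMap.sum_apply] at hpos
  rw [integral_sub (integrable_finsetSum _ fun f _ => integrable_continuousMap ν (G N f))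
    (integrable_const _), integral_finsetSum _ fun f _ => integrable_continuousMap ν (G N f)]
    at hpos
  simp only [integral_const, probReal_univ, one_smul] at hpos
  linarith

/-- The window `{m + 1, …, m + N}` of positive integers. -/
def pnatWindow (m N : ℕ) : Finset ℕ+ := (Finset.range N).image fun n => (m + n).succPNat

theorem succPNat_add_injective (m : ℕ) : Function.Injective fun n => (m + n).succPNat :=
  Nat.succPNat_injective.comp (add_right_injective m)

theorem card_pnatWindow (m N : ℕ) : (pnatWindow m N).card = N := by
  rw [pnatWindow, Finset.card_image_of_injective _ (succPNat_add_injective m), Finset.card_range]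

theorem mem_pnatWindow {m N : ℕ} {n : ℕ+} : n ∈ pnatWindow m N ↔ m < n ∧ (n : ℕ) ≤ m + N := by
  simp only [pnatWindow, Finset.mem_image, Finset.mem_range]
  constructor
  · rintro ⟨i, hi, rfl⟩
    simp only [Nat.succPNat_coe]
    omega
  · rintro ⟨h1, h2⟩
    refine ⟨n - m - 1, by omega, PNat.eq ?_⟩
    simp only [Nat.succPNat_coe]
    omega

theorem card_symmDiff_pnatWindow_le (m N : ℕ) (k : ℕ+) :
    (symmDiff (pnatWindow m N) ((pnatWindow m N).image fun n => n + k)).card ≤ 2 * k := by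
  have hsub : symmDiff (pnatWindow m N) ((pnatWindow m N).image fun n => n + k) ⊆
      pnatWindow m k ∪ pnatWindow (m + N) k := by
    intro n hn
    have himg : n ∈ (pnatWindow m N).image (fun n => n + k) ↔
        m + k < (n : ℕ) ∧ (n : ℕ) ≤ m + N + k := by
      simp only [Finset.mem_image, mem_pnatWindow]
      constructor
      · rintro ⟨i, hi, rfl⟩
        rw [PNat.add_coe]
        omega
      · rintro ⟨h1, h2⟩
        have hlt : k < n := PNat.coe_lt_coe _ _ |>.1 (by omega)
        refine ⟨n - k, ?_, PNat.sub_add_of_lt hlt⟩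
        rw [PNat.sub_coe, if_pos hlt]
        omega
    rw [Finset.mem_symmDiff, himg, mem_pnatWindow] at hn
    rw [Finset.mem_union, mem_pnatWindow, mem_pnatWindow]
    omega
  refine (Finset.card_le_card hsub).trans ((Finset.card_union_le _ _).trans ?_)
  rw [card_pnatWindow, card_pnatWindow, two_mul]

theorem isFolner_pnatWindow (m : ℕ → ℕ) {L : ℕ → ℕ} (hL : ∀ N, N < L N) :
    IsFolner fun N => pnatWindow (m N) (L N) where
  nonempty N := by
    rw [← Finset.card_pos, card_pnatWindow]
    exact (Nat.zero_le N).trans_lt (hL N)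
  tendsto k := by
    have hlim : Tendsto (fun N => (2 * k : ℝ) / (L N : ℝ)) atTop (𝓝 0) :=
      tendsto_const_nhds.div_atTop (tendsto_natCast_atTop_atTop.comp
        (tendsto_atTop_mono (fun N => (hL N).le) tendsto_id))
    refine squeeze_zero (fun N => by positivity) (fun N => ?_) hlim
    rw [card_pnatWindow]
    gcongr
    exact_mod_cast card_symmDiff_pnatWindow_le (m N) (L N) k

/-- A point whose orbit closure carries the ergodic measure `ν` is generic for `ν` along some
Følner sequence. -/
theorem exists_isFolner_isGeneric {S : C(X, X)} {a : X} {ν : Measure X}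
    [IsProbabilityMeasure ν] (hS : Ergodic S ν)
    (hν : ∀ f : C(X, ℝ), (∀ n : ℕ, 0 ≤ f (S^[n] a)) → 0 ≤ ∫ x, f x ∂ν) :
    ∃ Φ : ℕ → Finset ℕ+, IsFolner Φ ∧ IsGeneric S ν Φ a := by
  classical
  let d := TopologicalSpace.denseSeq C(X, ℂ)
  have hd : DenseRange d := TopologicalSpace.denseRange_denseSeq _
  -- The composition with `S` accounts for the window `{m + 1, …, m + L}` starting at `m + 1`, not
  -- `m`.
  have hex (N : ℕ) : ∃ L m : ℕ, N < L ∧ ∀ i ≤ N,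
      ‖birkhoffMap S L ((d i).comp S) (S^[m] a) - ∫ x, (d i).comp S x ∂ν‖ < 1 / ((N : ℝ) + 1) := by
    obtain ⟨L, ⟨m, hm⟩, hL⟩ := ((eventually_exists_birkhoffMap_close hS hν
      ((Finset.range (N + 1)).image fun i => (d i).comp S) (Nat.one_div_pos_of_nat (n := N))).and
      (eventually_gt_atTop N)).exists
    exact ⟨L, m, hL, fun i hi => hm _ (Finset.mem_image_of_mem _ (Finset.mem_range.2 (by omega)))⟩
  choose L m hL hclose using hex
  let Φ : ℕ → Finset ℕ+ := fun N => pnatWindow (m N) (L N)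
  let B : ℕ → C(X, ℂ) → ℂ := fun N f => ((Φ N).card : ℂ)⁻¹ * ∑ n ∈ Φ N, f (S^[(n : ℕ)] a)
  have hB (N : ℕ) (f : C(X, ℂ)) : B N f = birkhoffMap S (L N) (f.comp S) (S^[m N] a) := by
    simp only [B, Φ, card_pnatWindow, birkhoffMap_apply]
    rw [pnatWindow, Finset.sum_image (succPNat_add_injective (m N)).injOn]
    congr 1
    refine Finset.sum_congr rfl fun n _ => ?_
    rw [ContinuousMap.comp_apply, ← Function.iterate_add_apply, ← Function.iterate_succ_apply' S,
      Nat.succPNat_coe, add_comm n]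
  have hdense (i : ℕ) : Tendsto (fun N => B N (d i)) atTop (𝓝 (∫ x, d i x ∂ν)) := by
    rw [tendsto_iff_norm_sub_tendsto_zero]
    refine squeeze_zero' (.of_forall fun _ => norm_nonneg _) ?_
      tendsto_one_div_add_atTop_nhds_zero_nat
    filter_upwards [eventually_ge_atTop i] with N hN
    have := (hclose N i hN).le
    rw [← hB] at this
    have hint : ∫ x, (d i).comp S x ∂ν = ∫ x, d i x ∂ν := by
      conv_rhs => rw [← hS.toMeasurePreserving.map_eq]
      rw [integral_map S.continuous.aemeasurable (d i).continuous.aestronglyMeasurable]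
      rfl
    rwa [hint] at this
  refine ⟨Φ, isFolner_pnatWindow m hL, fun f => ?_⟩
  change Tendsto (fun N => B N f) atTop _
  have hBsub (N : ℕ) (f g : C(X, ℂ)) : ‖B N f - B N g‖ ≤ ‖f - g‖ := by
    have hLpos : (0 : ℝ) < L N := by exact_mod_cast (Nat.zero_le N).trans_lt (hL N)
    simp only [B, Φ, card_pnatWindow]
    rw [← mul_sub, ← Finset.sum_sub_distrib, norm_mul, norm_inv, RCLike.norm_natCast,
      inv_mul_le_iff₀ hLpos]
    refine (norm_sum_le _ _).trans ((Finset.sum_le_card_nsmul _ _ ‖f - g‖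
      fun n _ => (f - g).norm_coe_le_norm _).trans ?_)
    rw [nsmul_eq_mul, card_pnatWindow]
  rw [Metric.tendsto_atTop]
  intro ε hε
  obtain ⟨i, hi⟩ := hd.exists_dist_lt f (ε := ε / 3) (by positivity)
  obtain ⟨N₀, hN₀⟩ := Metric.tendsto_atTop.1 (hdense i) (ε / 3) (by positivity)
  refine ⟨N₀, fun N hN => ?_⟩
  have h1 : dist (B N f) (B N (d i)) < ε / 3 := by
    rw [dist_eq_norm]
    exact (hBsub N f (d i)).trans_lt (by rwa [← dist_eq_norm])
  have h2 := hN₀ N hN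
  have h3 : dist (∫ x, d i x ∂ν) (∫ x, f x ∂ν) < ε / 3 := by
    rw [dist_comm, dist_eq_norm, ← integral_sub (integrable_continuousMap ν f)
      (integrable_continuousMap ν (d i))]
    refine lt_of_le_of_lt ?_ (by rwa [dist_eq_norm] at hi : ‖f - d i‖ < ε / 3)
    simpa using norm_integral_le_of_norm_le_const (μ := ν)
      (.of_forall (f - d i).norm_coe_le_norm)
  linarith [dist_triangle4 (B N f) (B N (d i)) (∫ x, d i x ∂ν) (∫ x, f x ∂ν)]

end

section

/-! ### From a `T^k`-ergodic measure to a `T`-ergodic one -/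

section PowAverage

variable {X : Type*} [MeasurableSpace X]

/-- The average of the push-forwards of `ν` under the first `k` iterates of `T`. -/
noncomputable def powAverage (T : X → X) (k : ℕ+) (ν : Measure X) : Measure X :=
  ((k : ℕ) : ℝ≥0∞)⁻¹ • ∑ j ∈ Finset.range (k : ℕ), ν.map (T^[j])

theorem powAverage_apply {T : X → X} (hT : Measurable T) (k : ℕ+) (ν : Measure X) {B : Set X}
    (hB : MeasurableSet B) :
    powAverage T k ν B = ((k : ℕ) : ℝ≥0∞)⁻¹ * ∑ j ∈ Finset.range (k : ℕ), ν (T^[j] ⁻¹' B) := by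
  simp only [powAverage, Measure.smul_apply, Measure.finsetSum_apply, smul_eq_mul]
  congr 1
  exact Finset.sum_congr rfl fun j _ => Measure.map_apply (hT.iterate j) hB

theorem powAverage_eq_zero_iff {T : X → X} (hT : Measurable T) (k : ℕ+) (ν : Measure X) {B : Set X}
    (hB : MeasurableSet B) :
    powAverage T k ν B = 0 ↔ ∀ j < (k : ℕ), ν (T^[j] ⁻¹' B) = 0 := by
  simp [powAverage_apply hT k ν hB]

theorem measurePreserving_powAverage {T : X → X} (hT : Measurable T) {k : ℕ+} {ν : Measure X}
    (hν : MeasurePreserving (T^[(k : ℕ)]) ν ν) :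
    MeasurePreserving T (powAverage T k ν) (powAverage T k ν) := by
  refine ⟨hT, Measure.ext fun B hB => ?_⟩
  have h0 : ν (T^[(k : ℕ)] ⁻¹' B) = ν (T^[0] ⁻¹' B) := hν.measure_preimage hB.nullMeasurableSet
  rw [Measure.map_apply hT hB, powAverage_apply hT k ν (hT hB), powAverage_apply hT k ν hB]
  have hstep (j : ℕ) : ν (T^[j] ⁻¹' (T ⁻¹' B)) = ν (T^[j + 1] ⁻¹' B) := by
    rw [Function.iterate_succ', Set.preimage_comp]
  simp only [hstep]
  obtain ⟨k', hk'⟩ := Nat.exists_eq_succ_of_ne_zero k.ne_zero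
  rw [hk', Nat.succ_eq_add_one] at h0 ⊢
  rw [Finset.sum_range_succ, Finset.sum_range_succ' _ k', h0]

theorem isProbabilityMeasure_powAverage {T : X → X} (hT : Measurable T) (k : ℕ+) (ν : Measure X)
    [IsProbabilityMeasure ν] : IsProbabilityMeasure (powAverage T k ν) := by
  constructor
  rw [powAverage_apply hT k ν .univ]
  simp [ENNReal.inv_mul_cancel]

/-- A `T`-invariant set is `T^k`-invariant, hence trivial for `ν`, and every push-forward gives it
the same measure. -/
theorem ergodic_powAverage {T : X → X} (hT : Measurable T) {k : ℕ+} {ν : Measure X}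
    (hν : Ergodic (T^[(k : ℕ)]) ν) : Ergodic T (powAverage T k ν) := by
  refine ⟨measurePreserving_powAverage hT hν.toMeasurePreserving, ⟨fun B hB hTB => ?_⟩⟩
  have hpre (j : ℕ) : T^[j] ⁻¹' B = B := by
    rw [Set.preimage_iterate_eq]
    exact Function.iterate_fixed hTB j
  have hnull {C : Set X} (hC : MeasurableSet C) (hTC : ∀ j, T^[j] ⁻¹' C = C) (h : ν C = 0) :
      powAverage T k ν C = 0 :=
    (powAverage_eq_zero_iff hT k ν hC).2 fun j _ => by rwa [hTC]
  have hconst := hν.toPreErgodic.aeconst_set hB (hpre k)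
  rw [eventuallyConst_set] at hconst ⊢
  simp only [ae_iff, not_not] at hconst ⊢
  refine hconst.imp (fun h => ?_) (fun h => hnull hB hpre h)
  exact hnull (C := Bᶜ) hB.compl (fun j => by rw [Set.preimage_compl, hpre j]) h

end PowAverage

/-! ### Return times and the correspondence principle -/

section Correspondence

variable {X : Type*} [MetricSpace X]

theorem ae_mem_of_orbit_mem [CompactSpace X] [MeasurableSpace X] [BorelSpace X] {S : X → X} {a : X}
    {ν : Measure X} [IsFiniteMeasure ν]
    (hν : ∀ f : C(X, ℝ), (∀ n : ℕ, 0 ≤ f (S^[n] a)) → 0 ≤ ∫ x, f x ∂ν)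
    {C : Set X} (hC : IsClosed C) (ha : ∀ n : ℕ, S^[n] a ∈ C) : ∀ᵐ x ∂ν, x ∈ C := by
  let f : C(X, ℝ) := ⟨fun x => Metric.infDist x C, Metric.continuous_infDist_pt C⟩
  have hf : 0 ≤ (f : X → ℝ) := fun x => Metric.infDist_nonneg
  have h1 := hν (-f) fun n => by
    have : f (S^[n] a) = 0 := Metric.infDist_zero_of_mem (ha n)
    simp [this]
  simp only [ContinuousMap.neg_apply, integral_neg, Left.nonneg_neg_iff] at h1
  have h2 := (integral_eq_zero_iff_of_nonneg (f := f) hf (integrable_continuousMap ν f)).1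
    (le_antisymm h1 (integral_nonneg hf))
  filter_upwards [h2] with x hx
  exact (hC.mem_iff_infDist_zero ⟨_, ha 0⟩).2 hx

/-- The continuous function counting the visits to a clopen set `E` among the first `k` points of
an orbit. -/
noncomputable def visitCount (T : C(X, X)) (k : ℕ) {E : Set X} (hE : IsClopen E) : C(X, ℝ) :=
  ⟨fun x => ∑ j ∈ Finset.range k, E.indicator 1 (T^[j] x), by
    refine continuous_finsetSum _ fun j _ => ?_
    exact (hE.continuous_indicator (f := (1 : X → ℝ)) continuous_const).comp
      (T.continuous.iterate j)⟩

theorem visitCount_apply (T : C(X, X)) (k : ℕ) {E : Set X} (hE : IsClopen E) (x : X) :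
    visitCount T k hE x = ∑ j ∈ Finset.range k, E.indicator 1 (T^[j] x) := rfl

theorem integral_visitCount_eq_zero [MeasurableSpace X] {T : C(X, X)} {k : ℕ} {E : Set X} (hE : IsClopen E)
    {ν : Measure X} (h : ∀ j < k, ν (T^[j] ⁻¹' E) = 0) : ∫ x, visitCount T k hE x ∂ν = 0 := by
  refine integral_eq_zero_of_ae ?_
  have hae : ∀ᵐ x ∂ν, ∀ j ∈ Finset.range k, T^[j] x ∉ E :=
    (ae_ball_iff (Finset.range k).countable_toSet).2 fun j hj =>
      measure_eq_zero_iff_ae_notMem.1 (h j (Finset.mem_range.1 hj))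
  filter_upwards [hae] with x hx
  exact Finset.sum_eq_zero fun j hj => Set.indicator_of_notMem (hx j hj) _

variable [CompactSpace X]

theorem exists_visitCount_pos_state {T : C(X, X)} (a : X) {E : Set X} (hE : IsClopen E) (k : ℕ+)
    {S : C(X, X)} (hS : ⇑S = T^[(k : ℕ)]) {A : Set ℕ+} (hA : HasPosUpperBanachDensity A)
    (hAE : A = {n : ℕ+ | T^[(n : ℕ)] a ∈ E}) :
    ∃ Λ ∈ orbitStates S a, 0 < Λ (visitCount T k hE) := by
  classical
  obtain ⟨Φ, hΦ, δ, hδ, hlim⟩ := hA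
  obtain ⟨Λ, hΛ, hle⟩ := exists_mem_orbitStates_of_isFolner S a k hΦ
    (φ := visitCount T k hE) hlim fun N => by
      rw [div_eq_inv_mul]
      gcongr
      have hcard : ((A ∩ (Φ N : Set ℕ+)).ncard : ℝ) = ∑ n ∈ Φ N, A.indicator (1 : ℕ+ → ℝ) n := by
        have : A ∩ (Φ N : Set ℕ+) = ((Φ N).filter (· ∈ A) : Finset ℕ+) := by
          ext n; simp [and_comm]
        rw [this, Set.ncard_coe_finset, Finset.card_filter]
        push_cast
        exact Finset.sum_congr rfl fun n _ => by simp [Set.indicator_apply]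
      rw [hcard]
      refine Finset.sum_le_sum fun n _ => ?_
      rw [hS, ← Function.iterate_mul, visitCount_apply]
      have h0 (x : X) : (0 : ℝ) ≤ E.indicator 1 x := Set.indicator_nonneg (fun _ _ => zero_le_one) x
      refine le_trans (le_of_eq ?_) (Finset.single_le_sum (fun j _ => h0 _)
        (Finset.mem_range.2 (Nat.mod_lt (n : ℕ) k.pos)))
      rw [← Function.iterate_add_apply, Nat.mod_add_div, hAE]
      simp [Set.indicator_apply]
  exact ⟨Λ, hΛ, hδ.trans_le hle⟩

variable [MeasurableSpace X] [BorelSpace X]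

theorem exists_ergodic_system_of_return_times (T : X ≃ₜ X) (a : X) {E : Set X} (hE : IsClopen E)
    (k : ℕ+) {A : Set ℕ+} (hA : HasPosUpperBanachDensity A)
    (hAE : A = {n : ℕ+ | T^[(n : ℕ)] a ∈ E}) :
    ∃ (μ μk : Measure X) (Φ : ℕ → Finset ℕ+), IsErgodicSystem T μ ∧
      IsPowErgodicComponent T k μ μk ∧ IsFolner Φ ∧ IsGeneric (T^[(k : ℕ)]) μk Φ a ∧
      μ (closure (Set.range fun n : ℕ+ => T^[(n : ℕ)] a)) = 1 ∧ 0 < μ E := by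
  let T' : C(X, X) := ⟨T, T.continuous⟩
  let S : C(X, X) := ⟨T^[(k : ℕ)], T.continuous.iterate k⟩
  have hT : Measurable T := T.continuous.measurable
  obtain ⟨Λ, hΛ, hpos⟩ := exists_visitCount_pos_state (T := T') a hE k (S := S) rfl hA hAE
  obtain ⟨ν, hν, herg, hle, hstate⟩ := exists_ergodic_le_integral hΛ (visitCount T' k hE)
  obtain ⟨Φ, hΦ, hgen⟩ := exists_isFolner_isGeneric herg hstate
  have hprob := isProbabilityMeasure_powAverage hT k ν
  refine ⟨powAverage T k ν, ν, Φ, ⟨hprob, ergodic_powAverage hT herg⟩, ⟨hν, herg, rfl⟩, hΦ, hgen,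
    ?_, ?_⟩
  · set C := closure (Set.range fun n : ℕ+ => T^[(n : ℕ)] a)
    have hC : IsClosed C := isClosed_closure
    rw [← prob_compl_eq_zero_iff hC.measurableSet]
    -- The closure is taken over positive times only, so `a` itself may lie outside it; pulling back
    -- once by `T` makes every time positive.
    rw [← (measurePreserving_powAverage hT herg.toMeasurePreserving).measure_preimage
      hC.measurableSet.compl.nullMeasurableSet,
      powAverage_eq_zero_iff hT k ν (hT hC.measurableSet.compl)]
    intro j _
    refine measure_eq_zero_iff_ae_notMem.2 ?_
    refine (ae_mem_of_orbit_mem hstate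
      (hC.preimage (T.continuous.comp (T.continuous.iterate j))) fun n => ?_).mono
      fun x hx h => h hx
    change T (T^[j] ((T^[(k : ℕ)])^[n] a)) ∈ C
    rw [← Function.iterate_mul, ← Function.iterate_add_apply, ← Function.iterate_succ_apply' T]
    exact subset_closure ⟨(j + k * n).succPNat, rfl⟩
  · rw [pos_iff_ne_zero]
    intro h0
    rw [powAverage_eq_zero_iff hT k ν hE.isOpen.measurableSet] at h0
    rw [integral_visitCount_eq_zero (T := T') hE h0] at hle
    exact absurd hle (not_le.2 hpos)

end Correspondence

/-! ### The symbolic model -/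

/-- The two-sided shift on `ℤ → Bool`. -/
def boolShift : (ℤ → Bool) ≃ₜ (ℤ → Bool) where
  toFun x i := x (i + 1)
  invFun x i := x (i - 1)
  left_inv x := by simp
  right_inv x := by simp
  continuous_toFun := by fun_prop
  continuous_invFun := by fun_prop

theorem boolShift_iterate_apply (n : ℕ) (x : ℤ → Bool) (i : ℤ) :
    boolShift^[n] x i = x (i + n) := by
  induction n generalizing x with
  | zero => simp
  | succ n ih =>
    rw [Function.iterate_succ_apply, ih]
    change x (i + n + 1) = _
    push_cast
    rw [add_assoc]

end

theorem proposition4p1 (k : ℕ+) (A : Set ℕ+) (hA : HasPosUpperBanachDensity A) :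
    ∃ (X : Type) (_ : MetricSpace X) (_ : CompactSpace X) (_ : MeasurableSpace X)
      (_ : BorelSpace X) (T : X ≃ₜ X) (μ : Measure X),
      IsErgodicSystem T μ ∧
      ∃ (μk : Measure X) (Φ : ℕ → Finset ℕ+) (a : X) (E : Set X),
        IsPowErgodicComponent T k μ μk ∧
        IsFolner Φ ∧
        IsGeneric (T^[(k : ℕ)]) μk Φ a ∧
        μ (closure (Set.range fun n : ℕ+ => T^[(n : ℕ)] a)) = 1 ∧
        IsClopen E ∧
        0 < μ E ∧
        A = {n : ℕ+ | T^[(n : ℕ)] a ∈ E} := by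
  classical
  let a : ℤ → Bool := fun i => decide (∃ n ∈ A, ((n : ℕ) : ℤ) = i)
  let E : Set (ℤ → Bool) := {x | x 0 = true}
  have hE : IsClopen E := (isClopen_discrete {true}).preimage (continuous_apply 0)
  have hAE : A = {n : ℕ+ | boolShift^[(n : ℕ)] a ∈ E} := by
    ext n
    simp [E, a, boolShift_iterate_apply]
  let met : MetricSpace (ℤ → Bool) := TopologicalSpace.metrizableSpaceMetric _
  let meas : MeasurableSpace (ℤ → Bool) := borel _
  have hborel : BorelSpace (ℤ → Bool) := ⟨rfl⟩
  have hcpt : CompactSpace (ℤ → Bool) := Pi.compactSpace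
  obtain ⟨μ, μk, Φ, hμ, hμk, hΦ, hgen, hcl, hpos⟩ :=
    exists_ergodic_system_of_return_times boolShift a hE k hA hAE
  exact ⟨ℤ → Bool, met, hcpt, meas, hborel, boolShift, μ, hμ, μk, Φ, a, E, hμk, hΦ, hgen, hcl,
    hE, hpos, hAE⟩
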